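/- Consider algebras $\langle A,\vee,\wedge,\to,{}',0,1\rangle$ of type $(2,2,2,1,0,0)$ and put $x^*:=x\to 0$. Let $\mathbb{RUNO}1$ (regular unorthodox algebras of level 1) be the variety of those algebras for which $\langle A,\vee,\wedge,0,1\rangle$ is a lattice with least element $0$ and greatest element $1$, and which satisfy - (semi-Heyting) $x\wedge(x\to y)\approx x\wedge y$, $\;x\wedge(y\to z)\approx x\wedge[(x\wedge y)\to(x\wedge z)]$, $\;x\to x\approx 1$; - (De Morgan) $0'\approx 1$, $\;1'\approx 0$, $\;(x\wedge y)'\approx x'\vee y'$, $\;x''\approx x$; - (unorthodox) $(0\to 1)'\approx 0\to 1$; - (regular) $x\wedge ((x')^*)'\le y\vee y^*$; - (level 1) $x\wedge (x')^*\approx ((x\wedge (x')^*)')^*$. Let $\mathbb V$ be any subvariety of $\mathbb{RUNO}1$, that is, a class of algebras contained in $\mathbb{RUNO}1$ and closed under homomorphic images, subalgebras and direct products. Then $\mathbb V$ has the strong amalgamation property: for all $A,B,C\in\mathbb V$ and all embeddings (injective homomorphisms) $f:A\to B$ and $g:A\to C$ there are $D\in\mathbb V$ and embeddings $f_1:B\to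 D$ and $g_1:C\to D$ such that $f_1\circ f=g_1\circ g$ and $f_1(B)\cap g_1(C)=(f_1\circ f)(A)$. -/

import Mathlib

universe u

namespace Unorthodox

/-- Algebras of type `⟨∨, ∧, →, ', 0, 1⟩`. No identities are assumed. The operations are written
`x ⊔ y`, `x ⊓ y`, `x ⇨ y`, `dm x`, `⊥`, `⊤`. -/
class LAlg (A : Type u) extends Max A, Min A, HImp A, Bot A, Top A where
  /-- The unary operation `x ↦ x'`. -/
  dm : A → A

open LAlg

/-- The derived operation `x* = x → 0`. -/
def pc {A : Type u} [LAlg A] (x : A) : A := x ⇨ ⊥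

/-- Semi-Heyting algebras: bounded lattices (given by identities) satisfying the
semi-Heyting identities for `→`. -/
structure IsSemiHeyting (A : Type u) [LAlg A] : Prop where
  sup_comm : ∀ x y : A, x ⊔ y = y ⊔ x
  inf_comm : ∀ x y : A, x ⊓ y = y ⊓ x
  sup_assoc : ∀ x y z : A, x ⊔ y ⊔ z = x ⊔ (y ⊔ z)
  inf_assoc : ∀ x y z : A, x ⊓ y ⊓ z = x ⊓ (y ⊓ z)
  sup_inf_self : ∀ x y : A, x ⊔ x ⊓ y = x
  inf_sup_self : ∀ x y : A, x ⊓ (x ⊔ y) = x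
  bot_inf : ∀ x : A, ⊥ ⊓ x = ⊥
  top_inf : ∀ x : A, ⊤ ⊓ x = x
  inf_imp : ∀ x y : A, x ⊓ (x ⇨ y) = x ⊓ y
  inf_imp_inf : ∀ x y z : A, x ⊓ (y ⇨ z) = x ⊓ ((x ⊓ y) ⇨ (x ⊓ z))
  imp_self : ∀ x : A, x ⇨ x = ⊤

/-- Dually hemimorphic semi-Heyting algebras. -/
structure IsDHMSH (A : Type u) [LAlg A] : Prop extends IsSemiHeyting A where
  dm_bot : dm (⊥ : A) = ⊤
  dm_top : dm (⊤ : A) = ⊥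
  dm_inf : ∀ x y : A, dm (x ⊓ y) = dm x ⊔ dm y

/-- Dually quasi-De Morgan semi-Heyting algebras; `x'' ≤ x` is written `x'' ∧ x = x''`. -/
structure IsDQDSH (A : Type u) [LAlg A] : Prop extends IsDHMSH A where
  dm_dm_sup : ∀ x y : A, dm (dm (x ⊔ y)) = dm (dm x) ⊔ dm (dm y)
  dm_dm_le : ∀ x : A, dm (dm x) ⊓ x = dm (dm x)

/-- De Morgan semi-Heyting algebras. -/
structure IsDMSH (A : Type u) [LAlg A] : Prop extends IsDQDSH A where
  dm_dm : ∀ x : A, dm (dm x) = x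

/-- Unorthodox De Morgan semi-Heyting algebras: `(0 → 1)' = 0 → 1`. -/
structure IsUNO (A : Type u) [LAlg A] : Prop extends IsDMSH A where
  unorthodox : dm ((⊥ : A) ⇨ ⊤) = ⊥ ⇨ ⊤

/-- Regular unorthodox algebras: `x ∧ x'*' ≤ y ∨ y*`, with `p ≤ q` written `p ∧ q = p`. -/
structure IsRUNO (A : Type u) [LAlg A] : Prop extends IsUNO A where
  regular : ∀ x y : A,
    (x ⊓ dm (pc (dm x))) ⊓ (y ⊔ pc y) = x ⊓ dm (pc (dm x))

/-- Regular unorthodox algebras of level 1: `x ∧ x'* = (x ∧ x'*)'*`. -/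
structure IsRUNO1 (A : Type u) [LAlg A] : Prop extends IsRUNO A where
  level_one : ∀ x : A, x ⊓ pc (dm x) = pc (dm (x ⊓ pc (dm x)))

/-- Homomorphisms of algebras of type `⟨∨, ∧, →, ', 0, 1⟩`. -/
structure IsHom {A B : Type u} [LAlg A] [LAlg B] (f : A → B) : Prop where
  map_sup : ∀ x y, f (x ⊔ y) = f x ⊔ f y
  map_inf : ∀ x y, f (x ⊓ y) = f x ⊓ f y
  map_imp : ∀ x y, f (x ⇨ y) = f x ⇨ f y
  map_dm : ∀ x, f (dm x) = dm (f x)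
  map_bot : f ⊥ = ⊥
  map_top : f ⊤ = ⊤

/-- Embeddings: injective homomorphisms. -/
structure IsEmb {A B : Type u} [LAlg A] [LAlg B] (f : A → B) : Prop extends IsHom f where
  injective : Function.Injective f

/-- Direct products, with coordinatewise operations. -/
instance instLAlgPi {I : Type u} {A : I → Type u} [∀ i, LAlg (A i)] : LAlg (∀ i, A i) where
  max x y := fun i => x i ⊔ y i
  min x y := fun i => x i ⊓ y i
  himp x y := fun i => x i ⇨ y i
  bot := fun _ => ⊥
  top := fun _ => ⊤
  dm x := fun i => dm (x i)

/-- Bundled algebras of type `⟨∨, ∧, →, ', 0, 1⟩`. -/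
structure Alg : Type (u + 1) where
  /-- The underlying set. -/
  carrier : Type u
  /-- The operations. -/
  [str : LAlg carrier]

instance : CoeSort Alg.{u} (Type u) := ⟨Alg.carrier⟩

instance (A : Alg.{u}) : LAlg A := A.str

/-- The class of all regular unorthodox algebras of level 1. -/
def RUNO1 : Set Alg.{u} := {A | IsRUNO1 A}

/-- A variety: a class of algebras closed under homomorphic images, subalgebras (up to
isomorphism, hence all algebras that embed into a member), and arbitrary direct products. -/
structure IsVariety (K : Set Alg.{u}) : Prop where
  hom_image : ∀ A ∈ K, ∀ (B : Alg.{u}) (f : A → B), IsHom f → Function.Surjective f → B ∈ K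
  subalgebra : ∀ B ∈ K, ∀ (A : Alg.{u}) (f : A → B), IsEmb f → A ∈ K
  product : ∀ (I : Type u) (A : I → Alg.{u}), (∀ i, A i ∈ K) → Alg.mk (∀ i, A i) ∈ K

/-- The strong amalgamation property of a class of algebras. -/
def HasSAP (K : Set Alg.{u}) : Prop :=
  ∀ A ∈ K, ∀ B ∈ K, ∀ C ∈ K, ∀ (f : A → B) (g : A → C), IsEmb f → IsEmb g →
    ∃ D ∈ K, ∃ (f₁ : B → D) (g₁ : C → D), IsEmb f₁ ∧ IsEmb g₁ ∧ f₁ ∘ f = g₁ ∘ g ∧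
      Set.range f₁ ∩ Set.range g₁ = Set.range (f₁ ∘ f)

end Unorthodox

namespace Unorthodox

open LAlg

variable {A B : Type u} [LAlg A] [LAlg B]

/-! These algebras behave like Boolean products of rigid stalks. Level 1 makes `kernel x` central,
so central elements are plentiful: `agree x y` is the largest one on which x and y coincide. A prime
set P therefore yields a congruence, and A/P has only two central elements. The regular and
unorthodox identities then force every element of A/P to be one of 0, 1, 0 → 1, (0 → 1)*
(`eq_const_of_central`). Hence, if Q lies over P along f : A → B, then B/Q is a copy of A/P.

The amalgam is the product of the A/P over all triples (P, Q, R) with Q in B and R in C lying over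
P. Its factors are images of A, so it stays in the variety. Injectivity of f and g makes prime sets
extend, which gives embeddings. For strength, an element b outside f(A) produces a central element
outside f(A), which two prime sets over the same P separate (`exists_liesOver_separating`). Paired
with one common R, they prevent b from being identified with any element of C. -/

/-! ### The lattice reduct -/

/-- The lattice reduct of a semi-Heyting algebra. -/
abbrev IsSemiHeyting.lattice (h : IsSemiHeyting A) : Lattice A where
  sup := fun x y => x ⊔ y
  inf := fun x y => x ⊓ y
  le x y := x ⊓ y = x
  le_refl x := by simpa [h.sup_inf_self] using h.inf_sup_self x (x ⊓ x)
  le_trans x y z hxy hyz := by rw [← hxy, h.inf_assoc, hyz]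
  le_antisymm x y hxy hyx := by rw [← hxy, h.inf_comm, hyx]
  le_sup_left := h.inf_sup_self
  le_sup_right x y := by rw [h.sup_comm, h.inf_sup_self]
  sup_le x y z hx hy := by
    have hx' : x ⊔ z = z := by rw [← hx, h.sup_comm, h.inf_comm, h.sup_inf_self]
    have hy' : y ⊔ z = z := by rw [← hy, h.sup_comm, h.inf_comm, h.sup_inf_self]
    have : x ⊔ y ⊔ z = z := by rw [h.sup_assoc, hy', hx']
    change (x ⊔ y) ⊓ z = x ⊔ y
    rw [← this, h.inf_sup_self]
  inf_le_left x y := by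
    have hxx : x ⊓ x = x := by simpa [h.sup_inf_self] using h.inf_sup_self x (x ⊓ x)
    change (x ⊓ y) ⊓ x = x ⊓ y
    rw [h.inf_comm, ← h.inf_assoc, hxx]
  inf_le_right x y := by
    have hyy : y ⊓ y = y := by simpa [h.sup_inf_self] using h.inf_sup_self y (y ⊓ y)
    change (x ⊓ y) ⊓ y = x ⊓ y
    rw [h.inf_assoc, hyy]
  le_inf x y z hxy hxz := by
    rw [← h.inf_assoc, hxy, hxz]

/-- The lattice reduct of a semi-Heyting algebra is distributive. -/
abbrev IsSemiHeyting.distribLattice (h : IsSemiHeyting A) : DistribLattice A :=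
  letI := h.lattice
  DistribLattice.ofInfSupLe fun x y z => by
    -- In a semi-Heyting algebra the residual of x ⊓ · is w ↦ x ⇨ (x ⊓ w), not w ↦ x ⇨ w.
    have key : ∀ u w : A, x ⊓ u ≤ w → u ≤ x ⇨ (x ⊓ w) := fun u w huw => by
      have h2 : u ⊓ (x ⊓ w) = u ⊓ x := by
        rw [← _root_.inf_assoc, _root_.inf_comm u x]
        exact inf_eq_left.2 huw
      refine inf_eq_left.1 ?_
      rw [h.inf_imp_inf u x, h2, h.imp_self, h.inf_comm, h.top_inf]
    have h1 : y ⊔ z ≤ x ⇨ (x ⊓ (x ⊓ y ⊔ x ⊓ z)) :=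
      sup_le (key _ _ le_sup_left) (key _ _ le_sup_right)
    calc x ⊓ (y ⊔ z) ≤ x ⊓ (x ⇨ (x ⊓ (x ⊓ y ⊔ x ⊓ z))) := inf_le_inf_left x h1
      _ = x ⊓ (x ⊓ (x ⊓ y ⊔ x ⊓ z)) := h.inf_imp _ _
      _ ≤ x ⊓ y ⊔ x ⊓ z := inf_le_right.trans inf_le_right

/-! ### Auxiliary operations and relations -/

/-- An element whose De Morgan negation is a complement. -/
def IsCentral (z : A) : Prop := z ⊓ dm z = ⊥

/-- The largest central element below `x`. -/
def kernel (x : A) : A := x ⊓ pc (LAlg.dm x)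

/-- The largest central element on which `x` and `y` agree. -/
def agree (x y : A) : A := kernel ((x ⇨ y) ⊓ (y ⇨ x))

theorem IsHom.map_agree {f : A → B} (hf : IsHom f) (x y : A) :
    f (agree x y) = agree (f x) (f y) := by
  simp only [agree, kernel, pc, hf.map_inf, hf.map_imp, hf.map_dm, hf.map_bot]

theorem IsHom.map_isCentral {f : A → B} (hf : IsHom f) {z : A} (hz : IsCentral z) :
    IsCentral (f z) := by
  rw [IsCentral, ← hf.map_dm, ← hf.map_inf, show z ⊓ LAlg.dm z = ⊥ from hz, hf.map_bot]

/-- (The carrier of) a prime ideal. -/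
structure IsPrimeSet (P : Set A) : Prop where
  bot_mem : ⊥ ∈ P
  top_notMem : ⊤ ∉ P
  inf_mem_iff : ∀ x y, x ⊓ y ∈ P ↔ x ∈ P ∨ y ∈ P
  sup_mem_iff : ∀ x y, x ⊔ y ∈ P ↔ x ∈ P ∧ y ∈ P

theorem IsPrimeSet.preimage {f : A → B} (hf : IsHom f) {Q : Set B} (hQ : IsPrimeSet Q) :
    IsPrimeSet (f ⁻¹' Q) where
  bot_mem := by simpa [hf.map_bot] using hQ.bot_mem
  top_notMem := by simpa [hf.map_top] using hQ.top_notMem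
  inf_mem_iff x y := by simpa [hf.map_inf] using hQ.inf_mem_iff (f x) (f y)
  sup_mem_iff x y := by simpa [hf.map_sup] using hQ.sup_mem_iff (f x) (f y)

/-- The congruence attached to a prime set. -/
def primeRel (P : Set A) (x y : A) : Prop := agree x y ∉ P

section RUNO1

variable [hA : Fact (IsRUNO1 A)] [hB : Fact (IsRUNO1 B)]

instance : DistribLattice A := hA.out.toIsSemiHeyting.distribLattice

instance : BoundedOrder A where
  top := ⊤
  bot := ⊥
  le_top x := by
    refine inf_eq_left.1 ?_
    rw [inf_comm]
    exact hA.out.top_inf x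
  bot_le x := inf_eq_left.1 (hA.out.bot_inf x)

/-! ### Arithmetic -/

theorem dm_dm (x : A) : dm (dm x) = x := hA.out.dm_dm x

theorem dm_bot : dm (⊥ : A) = ⊤ := hA.out.dm_bot

theorem dm_top : dm (⊤ : A) = ⊥ := hA.out.dm_top

theorem dm_inf (x y : A) : dm (x ⊓ y) = dm x ⊔ dm y := hA.out.dm_inf x y

theorem dm_sup (x y : A) : dm (x ⊔ y) = dm x ⊓ dm y := by
  rw [← dm_dm (dm x ⊓ dm y), dm_inf, dm_dm, dm_dm]

theorem dm_le_dm {x y : A} (h : x ≤ y) : dm y ≤ dm x := by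
  rw [← inf_eq_left.2 h, dm_inf]
  exact le_sup_right

theorem imp_self (x : A) : x ⇨ x = ⊤ := hA.out.imp_self x

theorem inf_imp (x y : A) : x ⊓ (x ⇨ y) = x ⊓ y := hA.out.inf_imp x y

theorem inf_imp_inf (x y z : A) : x ⊓ (y ⇨ z) = x ⊓ ((x ⊓ y) ⇨ (x ⊓ z)) :=
  hA.out.inf_imp_inf x y z

theorem inf_pc (x : A) : x ⊓ pc x = ⊥ := by
  rw [pc, inf_imp, inf_bot_eq]

theorem le_pc {x y : A} (h : x ⊓ y = ⊥) : x ≤ pc y := by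
  rw [← inf_eq_left, pc, inf_imp_inf, h, inf_bot_eq, imp_self, inf_top_eq]

theorem pc_anti {x y : A} (h : x ≤ y) : pc y ≤ pc x := by
  refine le_pc (le_bot_iff.1 ?_)
  calc pc y ⊓ x ≤ pc y ⊓ y := inf_le_inf_left _ h
    _ = ⊥ := by rw [inf_comm, inf_pc]

theorem le_pc_pc (x : A) : x ≤ pc (pc x) := le_pc (inf_pc x)

/-! ### Central elements -/

theorem IsCentral.sup_dm {z : A} (hz : IsCentral z) : z ⊔ dm z = ⊤ := by
  rw [← dm_bot, ← show z ⊓ dm z = ⊥ from hz, dm_inf, dm_dm, sup_comm]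

theorem IsCentral.dm {z : A} (hz : IsCentral z) : IsCentral (dm z) := by
  rw [IsCentral, dm_dm, inf_comm]
  exact hz

theorem IsCentral.inf {z w : A} (hz : IsCentral z) (hw : IsCentral w) : IsCentral (z ⊓ w) := by
  rw [IsCentral, dm_inf, inf_sup_left, inf_right_comm, show z ⊓ LAlg.dm z = ⊥ from hz, inf_assoc,
    show w ⊓ LAlg.dm w = ⊥ from hw]
  simp

theorem IsCentral.sup {z w : A} (hz : IsCentral z) (hw : IsCentral w) : IsCentral (z ⊔ w) := by
  have := (hz.dm.inf hw.dm).dm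
  rwa [dm_inf, dm_dm, dm_dm] at this

theorem isCentral_top : IsCentral (⊤ : A) := by
  rw [IsCentral, dm_top, inf_bot_eq]

theorem IsCentral.pc_dm {z : A} (hz : IsCentral z) : pc (LAlg.dm z) = z := by
  refine le_antisymm ?_ (le_pc hz)
  refine inf_eq_left.1 ?_
  calc pc (LAlg.dm z) ⊓ z = pc (LAlg.dm z) ⊓ z ⊔ pc (LAlg.dm z) ⊓ LAlg.dm z := by
        rw [inf_comm (pc (LAlg.dm z)) (LAlg.dm z), inf_pc, sup_bot_eq]
    _ = pc (LAlg.dm z) := by rw [← inf_sup_left, hz.sup_dm, inf_top_eq]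

/-- Level 1 makes `kernel x` the pseudocomplement of its own negation. -/
theorem isCentral_kernel (x : A) : IsCentral (kernel x) := by
  have h : kernel x = pc (LAlg.dm (kernel x)) := hA.out.level_one x
  rw [IsCentral, inf_comm]
  nth_rewrite 2 [h]
  exact inf_pc _

theorem kernel_le (x : A) : kernel x ≤ x := inf_le_left

/-- The map x ↦ x'* is monotone and fixes central elements. -/
theorem IsCentral.le_kernel {z x : A} (hz : IsCentral z) (h : z ≤ x) : z ≤ kernel x :=
  le_inf h (hz.pc_dm.symm.le.trans (pc_anti (dm_le_dm h)))

theorem isCentral_agree (x y : A) : IsCentral (agree x y) := isCentral_kernel _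

theorem agree_inf (x y : A) : agree x y ⊓ x = agree x y ⊓ y := by
  have h1 : agree x y ⊓ x ≤ y := calc
    agree x y ⊓ x ≤ (x ⇨ y) ⊓ x := inf_le_inf_right _ ((kernel_le _).trans inf_le_left)
    _ = x ⊓ y := by rw [inf_comm, inf_imp]
    _ ≤ y := inf_le_right
  have h2 : agree x y ⊓ y ≤ x := calc
    agree x y ⊓ y ≤ (y ⇨ x) ⊓ y := inf_le_inf_right _ ((kernel_le _).trans inf_le_right)
    _ = y ⊓ x := by rw [inf_comm, inf_imp]
    _ ≤ x := inf_le_right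
  exact le_antisymm (le_inf inf_le_left h1) (le_inf inf_le_left h2)

theorem IsCentral.le_agree {z x y : A} (hz : IsCentral z) (h : z ⊓ x = z ⊓ y) :
    z ≤ agree x y := by
  refine hz.le_kernel (le_inf ?_ ?_) <;> rw [← inf_eq_left, inf_imp_inf, h, imp_self, inf_top_eq]

theorem eq_of_agree_eq_top {x y : A} (h : agree x y = ⊤) : x = y := by
  simpa [h] using agree_inf x y

theorem IsHom.monotone {f : A → B} (hf : IsHom f) {x y : A} (h : x ≤ y) : f x ≤ f y := by
  rw [← inf_eq_left, ← hf.map_inf, inf_eq_left.2 h]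

theorem IsCentral.inf_imp_congr {z x y u v : A} (h : z ⊓ x = z ⊓ y)
    (h' : z ⊓ u = z ⊓ v) : z ⊓ (x ⇨ u) = z ⊓ (y ⇨ v) := by
  rw [inf_imp_inf, h, h', ← inf_imp_inf]

/-- Negation is the one operation that needs z central: z ⊓ (z' ⊔ x') collapses to z ⊓ x'. -/
theorem IsCentral.inf_dm_congr {z x y : A} (hz : IsCentral z) (h : z ⊓ x = z ⊓ y) :
    z ⊓ LAlg.dm x = z ⊓ LAlg.dm y := by
  have h2 := congrArg (fun w => z ⊓ LAlg.dm w) h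
  simpa [dm_inf, inf_sup_left, show z ⊓ LAlg.dm z = ⊥ from hz] using h2

/-! ### Prime sets -/

theorem IsPrimeSet.mem_of_le {P : Set A} (hP : IsPrimeSet P) {x y : A} (h : x ≤ y) (hy : y ∈ P) :
    x ∈ P := by
  rw [← inf_eq_left.2 h, hP.inf_mem_iff]
  exact Or.inr hy

theorem IsPrimeSet.dm_mem_iff {P : Set A} (hP : IsPrimeSet P) {z : A} (hz : IsCentral z) :
    LAlg.dm z ∈ P ↔ z ∉ P := by
  constructor
  · intro h h'
    exact hP.top_notMem (hz.sup_dm ▸ (hP.sup_mem_iff _ _).2 ⟨h', h⟩)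
  · intro h
    have : z ⊓ LAlg.dm z ∈ P := by
      rw [show z ⊓ LAlg.dm z = ⊥ from hz]
      exact hP.bot_mem
    exact ((hP.inf_mem_iff _ _).1 this).resolve_left h

theorem exists_isPrimeSet_disjoint {W : Set A} (hne : W.Nonempty)
    (hinf : ∀ x ∈ W, ∀ y ∈ W, x ⊓ y ∈ W) (hbot : ⊥ ∉ W) :
    ∃ P : Set A, IsPrimeSet P ∧ ∀ x ∈ W, x ∉ P := by
  have hF : Order.IsPFilter {x : A | ∃ w ∈ W, w ≤ x} := by
    refine Order.IsPFilter.of_def ?_ ?_ ?_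
    · obtain ⟨w, hw⟩ := hne
      exact ⟨w, w, hw, le_rfl⟩
    · rintro x ⟨w, hw, hwx⟩ y ⟨v, hv, hvy⟩
      exact ⟨w ⊓ v, ⟨_, hinf w hw v hv, le_rfl⟩, inf_le_left.trans hwx, inf_le_right.trans hvy⟩
    · rintro x y hxy ⟨w, hw, hwx⟩
      exact ⟨w, hw, hwx.trans hxy⟩
  obtain ⟨J, hJ, -, hd⟩ := DistribLattice.prime_ideal_of_disjoint_filter_ideal
    (F := hF.toPFilter) (I := Order.Ideal.principal ⊥) (by
      rw [Set.disjoint_left]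
      rintro x ⟨w, hw, hwx⟩ hx
      have hw' : w = ⊥ := le_bot_iff.1 (hwx.trans (Order.Ideal.mem_principal.1 hx))
      exact hbot (hw' ▸ hw))
  refine ⟨J, ⟨J.bot_mem, fun h => hJ.1.1 ?_, fun x y => ⟨fun h => hJ.mem_or_mem h, ?_⟩,
    fun x y => Order.Ideal.sup_mem_iff⟩, fun x hx => Set.disjoint_left.1 hd ⟨x, hx, le_rfl⟩⟩
  · exact Set.eq_univ_of_forall fun x => J.lower le_top h
  · rintro (h | h)
    · exact J.lower inf_le_left h
    · exact J.lower inf_le_right h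

/-! ### The congruence attached to a prime set -/

theorem IsPrimeSet.primeRel_iff {P : Set A} (hP : IsPrimeSet P) {x y : A} :
    primeRel P x y ↔ ∃ z, IsCentral z ∧ z ∉ P ∧ z ⊓ x = z ⊓ y :=
  ⟨fun h => ⟨_, isCentral_agree x y, h, agree_inf x y⟩,
    fun ⟨_, hz, hzP, h⟩ h' => hzP (hP.mem_of_le (hz.le_agree h) h')⟩

theorem IsPrimeSet.primeRel_refl {P : Set A} (hP : IsPrimeSet P) (x : A) : primeRel P x x :=
  hP.primeRel_iff.2 ⟨⊤, isCentral_top, hP.top_notMem, rfl⟩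

theorem IsPrimeSet.primeRel_symm {P : Set A} (hP : IsPrimeSet P) {x y : A}
    (h : primeRel P x y) : primeRel P y x := by
  obtain ⟨z, hz, hzP, h⟩ := hP.primeRel_iff.1 h
  exact hP.primeRel_iff.2 ⟨z, hz, hzP, h.symm⟩

theorem IsPrimeSet.exists_central_of_primeRel {P : Set A} (hP : IsPrimeSet P) {x y u v : A}
    (h : primeRel P x y) (h' : primeRel P u v) :
    ∃ z, IsCentral z ∧ z ∉ P ∧ z ⊓ x = z ⊓ y ∧ z ⊓ u = z ⊓ v := by
  obtain ⟨z, hz, hzP, h⟩ := hP.primeRel_iff.1 h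
  obtain ⟨w, hw, hwP, h'⟩ := hP.primeRel_iff.1 h'
  refine ⟨z ⊓ w, hz.inf hw, ?_, ?_, ?_⟩
  · rw [hP.inf_mem_iff]
    tauto
  · rw [inf_right_comm, h, inf_right_comm]
  · rw [inf_assoc, h', inf_assoc]

theorem IsPrimeSet.primeRel_trans {P : Set A} (hP : IsPrimeSet P) {x y w : A}
    (h : primeRel P x y) (h' : primeRel P y w) : primeRel P x w := by
  obtain ⟨z, hz, hzP, h, h'⟩ := hP.exists_central_of_primeRel h h'
  exact hP.primeRel_iff.2 ⟨z, hz, hzP, h.trans h'⟩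

theorem IsPrimeSet.primeRel_sup {P : Set A} (hP : IsPrimeSet P) {x y u v : A}
    (h : primeRel P x y) (h' : primeRel P u v) : primeRel P (x ⊔ u) (y ⊔ v) := by
  obtain ⟨z, hz, hzP, h, h'⟩ := hP.exists_central_of_primeRel h h'
  exact hP.primeRel_iff.2 ⟨z, hz, hzP, by rw [inf_sup_left, h, h', ← inf_sup_left]⟩

theorem IsPrimeSet.primeRel_inf {P : Set A} (hP : IsPrimeSet P) {x y u v : A}
    (h : primeRel P x y) (h' : primeRel P u v) : primeRel P (x ⊓ u) (y ⊓ v) := by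
  obtain ⟨z, hz, hzP, h, h'⟩ := hP.exists_central_of_primeRel h h'
  exact hP.primeRel_iff.2 ⟨z, hz, hzP, by rw [inf_inf_distrib_left, h, h', ← inf_inf_distrib_left]⟩

theorem IsPrimeSet.primeRel_imp {P : Set A} (hP : IsPrimeSet P) {x y u v : A}
    (h : primeRel P x y) (h' : primeRel P u v) : primeRel P (x ⇨ u) (y ⇨ v) := by
  obtain ⟨z, hz, hzP, h, h'⟩ := hP.exists_central_of_primeRel h h'
  exact hP.primeRel_iff.2 ⟨z, hz, hzP, IsCentral.inf_imp_congr h h'⟩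

theorem IsPrimeSet.primeRel_dm {P : Set A} (hP : IsPrimeSet P) {x y : A}
    (h : primeRel P x y) : primeRel P (LAlg.dm x) (LAlg.dm y) := by
  obtain ⟨z, hz, hzP, h⟩ := hP.primeRel_iff.1 h
  exact hP.primeRel_iff.2 ⟨z, hz, hzP, hz.inf_dm_congr h⟩

/-- The setoid of the congruence attached to a prime set. -/
def IsPrimeSet.setoid {P : Set A} (hP : IsPrimeSet P) : Setoid A where
  r := primeRel P
  iseqv := ⟨hP.primeRel_refl, hP.primeRel_symm, hP.primeRel_trans⟩

/-- The quotient by the congruence attached to a prime set. -/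
def IsPrimeSet.Quot {P : Set A} (hP : IsPrimeSet P) : Type u := Quotient hP.setoid

instance {P : Set A} (hP : IsPrimeSet P) : LAlg hP.Quot where
  max := Quotient.map₂ (fun x y => x ⊔ y) fun _ _ h _ _ h' => hP.primeRel_sup h h'
  min := Quotient.map₂ (fun x y => x ⊓ y) fun _ _ h _ _ h' => hP.primeRel_inf h h'
  himp := Quotient.map₂ (fun x y => x ⇨ y) fun _ _ h _ _ h' => hP.primeRel_imp h h'
  dm := Quotient.map LAlg.dm fun _ _ h => hP.primeRel_dm h
  bot := Quotient.mk hP.setoid ⊥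
  top := Quotient.mk hP.setoid ⊤

/-- The quotient map. -/
def IsPrimeSet.proj {P : Set A} (hP : IsPrimeSet P) (x : A) : hP.Quot := Quotient.mk hP.setoid x

theorem IsPrimeSet.proj_surjective {P : Set A} (hP : IsPrimeSet P) : Function.Surjective hP.proj :=
  Quotient.mk_surjective

theorem IsPrimeSet.proj_eq_proj {P : Set A} (hP : IsPrimeSet P) {x y : A} :
    hP.proj x = hP.proj y ↔ agree x y ∉ P :=
  Quotient.eq (r := hP.setoid)

theorem IsPrimeSet.isHom_proj {P : Set A} (hP : IsPrimeSet P) : IsHom hP.proj where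
  map_sup _ _ := rfl
  map_inf _ _ := rfl
  map_imp _ _ := rfl
  map_dm _ := rfl
  map_bot := rfl
  map_top := rfl

theorem IsRUNO1.of_surjective {A B : Type u} [LAlg A] [LAlg B]
    (h : IsRUNO1 A) {f : A → B} (hf : IsHom f) (hs : Function.Surjective f) : IsRUNO1 B where
  sup_comm := hs.forall₂.2 fun x y => by rw [← hf.map_sup, h.sup_comm, hf.map_sup]
  inf_comm := hs.forall₂.2 fun x y => by rw [← hf.map_inf, h.inf_comm, hf.map_inf]
  sup_assoc := hs.forall₃.2 fun x y z => by simp only [← hf.map_sup, h.sup_assoc]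
  inf_assoc := hs.forall₃.2 fun x y z => by simp only [← hf.map_inf, h.inf_assoc]
  sup_inf_self := hs.forall₂.2 fun x y => by
    simp only [← hf.map_sup, ← hf.map_inf, h.sup_inf_self]
  inf_sup_self := hs.forall₂.2 fun x y => by
    simp only [← hf.map_sup, ← hf.map_inf, h.inf_sup_self]
  bot_inf := hs.forall.2 fun x => by simp only [← hf.map_bot, ← hf.map_inf, h.bot_inf]
  top_inf := hs.forall.2 fun x => by simp only [← hf.map_top, ← hf.map_inf, h.top_inf]
  inf_imp := hs.forall₂.2 fun x y => by simp only [← hf.map_imp, ← hf.map_inf, h.inf_imp]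
  inf_imp_inf := hs.forall₃.2 fun x y z => by
    simp only [← hf.map_imp, ← hf.map_inf]
    rw [h.inf_imp_inf]
  imp_self := hs.forall.2 fun x => by rw [← hf.map_imp, h.imp_self, hf.map_top]
  dm_bot := by rw [← hf.map_bot, ← hf.map_dm, h.dm_bot, hf.map_top]
  dm_top := by rw [← hf.map_top, ← hf.map_dm, h.dm_top, hf.map_bot]
  dm_inf := hs.forall₂.2 fun x y => by
    simp only [← hf.map_dm, ← hf.map_inf, ← hf.map_sup, h.dm_inf]
  dm_dm_sup := hs.forall₂.2 fun x y => by
    simp only [← hf.map_dm, ← hf.map_sup, h.dm_dm]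
  dm_dm_le := hs.forall.2 fun x => by
    simp only [← hf.map_dm, ← hf.map_inf, h.dm_dm_le]
  dm_dm := hs.forall.2 fun x => by simp only [← hf.map_dm, h.dm_dm]
  unorthodox := by
    rw [← hf.map_bot, ← hf.map_top, ← hf.map_imp, ← hf.map_dm, h.unorthodox]
  regular := hs.forall₂.2 fun x y => by
    simp only [pc, ← hf.map_bot, ← hf.map_dm, ← hf.map_inf, ← hf.map_sup, ← hf.map_imp]
    exact congrArg f (h.regular x y)
  level_one := hs.forall.2 fun x => by
    simp only [pc, ← hf.map_bot, ← hf.map_dm, ← hf.map_inf, ← hf.map_imp]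
    exact congrArg f (h.level_one x)

/-! ### Algebras with two central elements -/

/-- The constant `0 → 1`. -/
def mid (A : Type u) [LAlg A] : A := ⊥ ⇨ ⊤

/-- The constants which exhaust every algebra with two central elements. -/
def IsConst {A : Type u} [LAlg A] (k : A) : Prop := k = ⊥ ∨ k = ⊤ ∨ k = mid A ∨ k = pc (mid A)

theorem IsHom.map_mid {A B : Type u} [LAlg A] [LAlg B] {f : A → B} (hf : IsHom f) :
    f (mid A) = mid B := by
  rw [mid, hf.map_imp, hf.map_bot, hf.map_top, mid]

theorem dm_mid : dm (mid A) = mid A := hA.out.unorthodox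

theorem mid_ne_bot [Nontrivial A] : mid A ≠ ⊥ := fun h => by
  have := dm_mid (A := A)
  rw [h, dm_bot] at this
  exact top_ne_bot this

theorem inf_dm_pc_le (x y : A) : x ⊓ dm (pc (dm x)) ≤ y ⊔ pc y :=
  inf_eq_left.1 (hA.out.regular x y)

theorem kernel_dm_eq_bot (hc : ∀ z : A, IsCentral z → z = ⊥ ∨ z = ⊤) {x : A} (hx : x ≠ ⊥) :
    dm x ⊓ pc x = ⊥ := by
  have h : kernel (dm x) = dm x ⊓ pc x := by rw [kernel, dm_dm]
  rw [← h]
  refine (hc _ (isCentral_kernel _)).resolve_right fun h' => hx ?_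
  have : dm x = ⊤ := top_le_iff.1 (h' ▸ kernel_le (dm x))
  rw [← dm_dm x, this, dm_top]

/-- Apply `kernel_dm_eq_bot` to x and to x*. Together they make x*' a complement of x, which forces
x*' = x*. Then x and x' both complement x*, and complements are unique. -/
theorem dm_eq_self_of_pc_ne_bot (hc : ∀ z : A, IsCentral z → z = ⊥ ∨ z = ⊤) {x : A}
    (hx : x ≠ ⊥) (hx' : pc x ≠ ⊥) : x ⊔ pc x = ⊤ ∧ dm x = x ∧ dm (pc x) = pc x := by
  have h1 := kernel_dm_eq_bot hc hx
  have h2 := kernel_dm_eq_bot hc hx'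
  have h3 : x ⊔ dm (pc x) = ⊤ := by
    rw [← dm_bot, ← h1, dm_inf, dm_dm]
  have h4 : x ⊓ dm (pc x) = ⊥ := by
    rw [← le_bot_iff, ← h2, inf_comm]
    exact inf_le_inf_left _ (le_pc_pc x)
  have h5 : dm (pc x) ≤ pc x := le_pc (by rw [inf_comm, h4])
  have h6 : pc x ≤ dm (pc x) := by
    rw [← inf_eq_left]
    calc pc x ⊓ dm (pc x) = pc x ⊓ x ⊔ pc x ⊓ dm (pc x) := by
          rw [inf_comm (pc x) x, inf_pc, bot_sup_eq]
      _ = pc x := by rw [← inf_sup_left, h3, inf_top_eq]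
  have h7 := le_antisymm h5 h6
  rw [h7] at h3 h4
  refine ⟨h3, ?_, h7⟩
  have h8 : dm x ⊔ pc x = ⊤ := by rw [← h7, ← dm_inf, h4, dm_bot]
  exact eq_of_inf_eq_sup_eq (h1.trans h4.symm) (h8.trans h3.symm)

theorem eq_const_of_central [Nontrivial A] (hc : ∀ z : A, IsCentral z → z = ⊥ ∨ z = ⊤) (x : A) :
    IsConst x := by
  -- Such a c is an atom: a nonzero c ⊓ x equals its own negation, which lies above c' = c.
  have key : ∀ c : A, dm c = c → pc c ≠ ⊥ → c ⊓ x = ⊥ ∨ c ⊓ x = c := fun c hcc hpc => by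
    by_cases h : c ⊓ x = ⊥
    · exact Or.inl h
    refine Or.inr (le_antisymm inf_le_left ?_)
    have h1 : pc (c ⊓ x) ≠ ⊥ := fun h' => hpc (le_bot_iff.1 (h' ▸ pc_anti inf_le_left))
    rw [← (dm_eq_self_of_pc_ne_bot hc h h1).2.1, dm_inf, hcc]
    exact le_sup_left
  by_cases hd : pc (mid A) = ⊥
  · by_cases hx : x = ⊥
    · exact Or.inl hx
    by_cases hx' : x = ⊤
    · exact Or.inr (Or.inl hx')
    -- First y* = 0: otherwise y ⊓ mid is self-negating, hence above mid' = mid, so y* ≤ mid* = 0.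
    -- Regularity at mid and y then reads mid ≤ y.
    have dense : ∀ y : A, y ≠ ⊥ → mid A ≤ y := fun y hy => by
      have hy' : pc y = ⊥ := by
        by_contra hy'
        have h1 : y ⊓ mid A ≠ ⊥ := fun h => hy (le_bot_iff.1 (hd ▸ le_pc h))
        have h2 : pc (y ⊓ mid A) ≠ ⊥ := fun h =>
          hy' (le_bot_iff.1 (h ▸ pc_anti inf_le_left))
        have h3 : mid A ≤ y := by
          refine le_trans ?_ (inf_le_left (b := mid A))
          rw [← (dm_eq_self_of_pc_ne_bot hc h1 h2).2.1, dm_inf, dm_mid]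
          exact le_sup_right
        exact hy' (le_bot_iff.1 (hd ▸ pc_anti h3))
      have h := inf_dm_pc_le (mid A) y
      rwa [dm_mid, hd, dm_bot, inf_top_eq, hy', sup_bot_eq] at h
    refine Or.inr (Or.inr (Or.inl (le_antisymm ?_ (dense x hx))))
    -- The dual bound x ≤ mid, since mid is its own negation.
    have h := dm_le_dm (dense (dm x) fun h => hx' (by rw [← dm_dm x, h, dm_bot]))
    rwa [dm_dm, dm_mid] at h
  · obtain ⟨h1, -, h3⟩ := dm_eq_self_of_pc_ne_bot hc mid_ne_bot hd
    have h4 : pc (pc (mid A)) ≠ ⊥ := fun h =>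
      mid_ne_bot (le_bot_iff.1 (h ▸ le_pc_pc (mid A)))
    have h5 : x = mid A ⊓ x ⊔ pc (mid A) ⊓ x := by
      rw [← inf_sup_right, h1, top_inf_eq]
    rcases key _ dm_mid hd with h | h <;> rcases key _ h3 h4 with h' | h' <;>
      rw [h, h'] at h5 <;> simp [IsConst, h5, h1]

/-! ### Quotients by prime sets -/

theorem IsPrimeSet.exists_const {P : Set A} (hP : IsPrimeSet P) (x : A) :
    ∃ k, IsConst k ∧ agree x k ∉ P := by
  have hhom := hP.isHom_proj
  have hQ : Fact (IsRUNO1 hP.Quot) := ⟨hA.out.of_surjective hhom hP.proj_surjective⟩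
  have hnt : Nontrivial hP.Quot := by
    refine ⟨⊤, ⊥, fun h => ?_⟩
    rw [← hhom.map_top, ← hhom.map_bot, hP.proj_eq_proj] at h
    obtain ⟨z, -, hz, h⟩ := hP.primeRel_iff.1 h
    rw [inf_top_eq, inf_bot_eq] at h
    exact hz (h ▸ hP.bot_mem)
  have hc : ∀ z : hP.Quot, IsCentral z → z = ⊥ ∨ z = ⊤ := fun z hz => by
    obtain ⟨a, rfl⟩ := hP.proj_surjective z
    -- A central class is its own kernel, so it lifts to a central element of A, and P decides
    -- whether that becomes 0 or 1.
    have h1 : hP.proj (kernel a) = hP.proj a := by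
      refine le_antisymm (hhom.monotone (kernel_le a)) ?_
      refine (hz.le_kernel le_rfl).trans_eq ?_
      simp only [kernel, pc, hhom.map_inf, hhom.map_imp, hhom.map_dm, hhom.map_bot]
    rw [← h1]
    have hk := isCentral_kernel a
    by_cases h : kernel a ∈ P
    · left
      rw [← hhom.map_bot, hP.proj_eq_proj]
      refine hP.primeRel_iff.2 ⟨dm (kernel a), hk.dm, fun h' => (hP.dm_mem_iff hk).1 h' h, ?_⟩
      rw [inf_bot_eq, inf_comm]
      exact hk
    · right
      rw [← hhom.map_top, hP.proj_eq_proj]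
      exact hP.primeRel_iff.2 ⟨kernel a, hk, h, by simp⟩
  have hpc : pc (mid hP.Quot) = hP.proj (pc (mid A)) := by
    rw [pc, pc, hhom.map_imp, hhom.map_mid, hhom.map_bot]
  rcases eq_const_of_central hc (hP.proj x) with h | h | h | h
  · exact ⟨⊥, by simp [IsConst], hP.proj_eq_proj.1 (h.trans hhom.map_bot.symm)⟩
  · exact ⟨⊤, by simp [IsConst], hP.proj_eq_proj.1 (h.trans hhom.map_top.symm)⟩
  · exact ⟨mid A, by simp [IsConst], hP.proj_eq_proj.1 (h.trans hhom.map_mid.symm)⟩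
  · exact ⟨pc (mid A), by simp [IsConst], hP.proj_eq_proj.1 (h.trans hpc)⟩

theorem IsHom.exists_const {A B : Type u} [LAlg A] [LAlg B] {f : A → B} (hf : IsHom f) {k : B}
    (hk : IsConst k) : ∃ k' : A, f k' = k := by
  rcases hk with rfl | rfl | rfl | rfl
  · exact ⟨⊥, hf.map_bot⟩
  · exact ⟨⊤, hf.map_top⟩
  · exact ⟨mid A, hf.map_mid⟩
  · exact ⟨pc (mid A), by rw [pc, pc, hf.map_imp, hf.map_mid, hf.map_bot]⟩

-- The constants lie in the image of f, so f(A) meets every class modulo Q.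
omit hA in
theorem IsPrimeSet.exists_agree_notMem {f : A → B} (hf : IsHom f) {Q : Set B}
    (hQ : IsPrimeSet Q) (b : B) : ∃ a, agree b (f a) ∉ Q := by
  obtain ⟨k, hk, h⟩ := hQ.exists_const b
  obtain ⟨a, rfl⟩ := hf.exists_const hk
  exact ⟨a, h⟩

/-- The prime set `Q` lies over the prime set `P` along `f`, as far as central elements are
concerned. -/
def LiesOver {A B : Type u} [LAlg A] [LAlg B] (f : A → B) (P : Set A) (Q : Set B) : Prop :=
  ∀ z, IsCentral z → (f z ∈ Q ↔ z ∈ P)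

/-- If `Q` lies over `P` along `f : A → B`, then `A/P` and `B/Q` are isomorphic; this is the
resulting map `B → A/P`. -/
noncomputable def IsPrimeSet.transfer {P : Set A} (hP : IsPrimeSet P) {f : A → B} (hf : IsHom f)
    {Q : Set B} (hQ : IsPrimeSet Q) (b : B) : hP.Quot :=
  hP.proj (hQ.exists_agree_notMem hf b).choose

section Transfer

variable {P : Set A} (hP : IsPrimeSet P) {f : A → B} (hf : IsHom f) {Q : Set B}
  (hQ : IsPrimeSet Q) (hPQ : LiesOver f P Q)

include hPQ

theorem IsPrimeSet.transfer_eq_iff {b : B} {a : A} :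
    hP.transfer hf hQ b = hP.proj a ↔ agree b (f a) ∉ Q := by
  have h : agree b (f (hQ.exists_agree_notMem hf b).choose) ∉ Q :=
    (hQ.exists_agree_notMem hf b).choose_spec
  rw [transfer, hP.proj_eq_proj, ← hPQ _ (isCentral_agree _ _), hf.map_agree]
  exact ⟨hQ.primeRel_trans h, hQ.primeRel_trans (hQ.primeRel_symm h)⟩

theorem IsPrimeSet.transfer_apply (a : A) : hP.transfer hf hQ (f a) = hP.proj a :=
  (hP.transfer_eq_iff hf hQ hPQ).2 (hQ.primeRel_refl _)

theorem IsPrimeSet.transfer_eq_transfer {b b' : B}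
    (h : hP.transfer hf hQ b = hP.transfer hf hQ b') : agree b b' ∉ Q := by
  obtain ⟨a, ha⟩ := hP.proj_surjective (hP.transfer hf hQ b')
  exact hQ.primeRel_trans ((hP.transfer_eq_iff hf hQ hPQ).1 (h.trans ha.symm))
    (hQ.primeRel_symm ((hP.transfer_eq_iff hf hQ hPQ).1 ha.symm))

theorem IsPrimeSet.isHom_transfer : IsHom (hP.transfer hf hQ) := by
  have key : ∀ b, ∃ a, hP.transfer hf hQ b = hP.proj a ∧ primeRel Q b (f a) := fun b => by
    obtain ⟨a, ha⟩ := hP.proj_surjective (hP.transfer hf hQ b)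
    exact ⟨a, ha.symm, (hP.transfer_eq_iff hf hQ hPQ).1 ha.symm⟩
  constructor
  · intro x y
    obtain ⟨a, ha, ha'⟩ := key x
    obtain ⟨b, hb, hb'⟩ := key y
    rw [ha, hb, ← hP.isHom_proj.map_sup, hP.transfer_eq_iff hf hQ hPQ, hf.map_sup]
    exact hQ.primeRel_sup ha' hb'
  · intro x y
    obtain ⟨a, ha, ha'⟩ := key x
    obtain ⟨b, hb, hb'⟩ := key y
    rw [ha, hb, ← hP.isHom_proj.map_inf, hP.transfer_eq_iff hf hQ hPQ, hf.map_inf]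
    exact hQ.primeRel_inf ha' hb'
  · intro x y
    obtain ⟨a, ha, ha'⟩ := key x
    obtain ⟨b, hb, hb'⟩ := key y
    rw [ha, hb, ← hP.isHom_proj.map_imp, hP.transfer_eq_iff hf hQ hPQ, hf.map_imp]
    exact hQ.primeRel_imp ha' hb'
  · intro x
    obtain ⟨a, ha, ha'⟩ := key x
    rw [ha, ← hP.isHom_proj.map_dm, hP.transfer_eq_iff hf hQ hPQ, hf.map_dm]
    exact hQ.primeRel_dm ha'
  · rw [← hf.map_bot, hP.transfer_apply hf hQ hPQ, hP.isHom_proj.map_bot]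
  · rw [← hf.map_top, hP.transfer_apply hf hQ hPQ, hP.isHom_proj.map_top]

end Transfer

/-! ### Extending and separating prime sets -/

/-- Avoiding all f w ⊓ z with w central outside P keeps z and these f w out of Q. Passing to dm w
puts f w into Q for central w in P. -/
theorem IsPrimeSet.exists_liesOver {P : Set A} (hP : IsPrimeSet P) {f : A → B} (hf : IsHom f)
    {z : B} (hz : ∀ w, IsCentral w → w ∉ P → f w ⊓ z ≠ ⊥) :
    ∃ Q : Set B, IsPrimeSet Q ∧ LiesOver f P Q ∧ z ∉ Q := by
  obtain ⟨Q, hQ, hQ'⟩ := exists_isPrimeSet_disjoint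
    (W := {b | ∃ w, IsCentral w ∧ w ∉ P ∧ f w ⊓ z = b})
    ⟨_, ⊤, isCentral_top, hP.top_notMem, rfl⟩ (by
      rintro _ ⟨w, hw, hwP, rfl⟩ _ ⟨v, hv, hvP, rfl⟩
      refine ⟨w ⊓ v, hw.inf hv, ?_, ?_⟩
      · rw [hP.inf_mem_iff]
        tauto
      · rw [hf.map_inf, inf_inf_distrib_right])
    (by
      rintro ⟨w, hw, hwP, h⟩
      exact hz w hw hwP h)
  have h1 : ∀ w, IsCentral w → w ∉ P → f w ∉ Q := fun w hw hwP h =>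
    hQ' _ ⟨w, hw, hwP, rfl⟩ (hQ.mem_of_le inf_le_left h)
  refine ⟨Q, hQ, fun w hw => ⟨fun h => by_contra fun h' => h1 w hw h' h, fun h => ?_⟩, fun h =>
    hQ' _ ⟨⊤, isCentral_top, hP.top_notMem, rfl⟩ (hQ.mem_of_le inf_le_right h)⟩
  by_contra h'
  have h2 := h1 _ hw.dm fun h3 => (hP.dm_mem_iff hw).1 h3 h
  rw [hf.map_dm, hQ.dm_mem_iff (hf.map_isCentral hw)] at h2
  exact h2 h'

theorem IsPrimeSet.exists_liesOver_of_isEmb {P : Set A} (hP : IsPrimeSet P) {f : A → B}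
    (hf : IsEmb f) : ∃ Q : Set B, IsPrimeSet Q ∧ LiesOver f P Q := by
  obtain ⟨Q, hQ, h, -⟩ := hP.exists_liesOver hf.toIsHom (z := ⊤) (by
    intro w _ hwP h
    rw [inf_top_eq, ← hf.map_bot] at h
    exact hwP (hf.injective h ▸ hP.bot_mem))
  exact ⟨Q, hQ, h⟩

theorem exists_isPrimeSet_mem {z : A} (hz : IsCentral z) (h : z ≠ ⊤) :
    ∃ P : Set A, IsPrimeSet P ∧ z ∈ P := by
  obtain ⟨P, hP, hP'⟩ := exists_isPrimeSet_disjoint (W := {dm z}) (Set.singleton_nonempty _)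
    (by simp) (by
      intro h'
      rw [Set.mem_singleton_iff] at h'
      exact h (by rw [← dm_dm z, ← h', dm_bot]))
  exact ⟨P, hP, by_contra fun h' => hP' _ rfl ((hP.dm_mem_iff hz).2 h')⟩

-- The elements `agree b k`, for the four constants k, join to 1, because no prime set contains them
-- all. Were they all in the image of f, b could be assembled there from its pieces `agree b k ⊓ k`.
omit hA in
theorem exists_agree_notMem_range {f : A → B} (hf : IsHom f) {b : B} (hb : b ∉ Set.range f) :
    ∃ k, agree b (f k) ∉ Set.range f := by
  by_contra! hall
  choose g hg using hall
  have hpc : f (pc (mid A)) = pc (mid B) := by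
    rw [pc, pc, hf.map_imp, hf.map_mid, hf.map_bot]
  let s : B := agree b (f ⊥) ⊔ agree b (f ⊤) ⊔ agree b (f (mid A)) ⊔ agree b (f (pc (mid A)))
  have hs : s = ⊤ := by
    by_contra h
    obtain ⟨Q, hQ, hsQ⟩ := exists_isPrimeSet_mem
      ((((isCentral_agree b (f ⊥)).sup (isCentral_agree b (f ⊤))).sup
        (isCentral_agree b (f (mid A)))).sup (isCentral_agree b (f (pc (mid A))))) h
    simp only [hQ.sup_mem_iff, hf.map_bot, hf.map_top, hf.map_mid, hpc] at hsQ
    obtain ⟨⟨⟨h1, h2⟩, h3⟩, h4⟩ := hsQ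
    obtain ⟨k, hk, hkQ⟩ := hQ.exists_const b
    rcases hk with rfl | rfl | rfl | rfl
    exacts [hkQ h1, hkQ h2, hkQ h3, hkQ h4]
  refine hb ⟨g ⊥ ⊓ ⊥ ⊔ g ⊤ ⊓ ⊤ ⊔ g (mid A) ⊓ mid A ⊔ g (pc (mid A)) ⊓ pc (mid A), ?_⟩
  simp only [hf.map_sup, hf.map_inf, hg, ← agree_inf]
  rw [← inf_sup_right, ← inf_sup_right, ← inf_sup_right]
  exact (congrArg (· ⊓ b) hs).trans (top_inf_eq b)

/-- P is chosen to contain every central u with f u ≤ z and every central v with f v ≤ z'. This is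
possible because u ⊔ v = 1 would give z = f u. No f w with w central outside P is then disjoint from
z or from z', so P extends both to a Q missing z and to a Q' containing it. -/
theorem exists_liesOver_separating {f : A → B} (hf : IsHom f) {z : B} (hz : IsCentral z)
    (hzf : z ∉ Set.range f) :
    ∃ (P : Set A) (Q Q' : Set B), IsPrimeSet P ∧ IsPrimeSet Q ∧ IsPrimeSet Q' ∧
      LiesOver f P Q ∧ LiesOver f P Q' ∧ z ∉ Q ∧ z ∈ Q' := by
  obtain ⟨P, hP, hP'⟩ := exists_isPrimeSet_disjoint
    (W := {a : A | ∃ u v, IsCentral u ∧ IsCentral v ∧ f u ≤ z ∧ f v ≤ dm z ∧ dm u ⊓ dm v = a})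
    -- Here `dm ⊤` plays the role of `⊥`, with centrality at hand.
    ⟨_, dm ⊤, dm ⊤, isCentral_top.dm, isCentral_top.dm, by simp [dm_top, hf.map_bot],
      by simp [dm_top, hf.map_bot], rfl⟩ (by
      rintro _ ⟨u, v, hu, hv, huz, hvz, rfl⟩ _ ⟨u', v', hu', hv', huz', hvz', rfl⟩
      refine ⟨u ⊔ u', v ⊔ v', hu.sup hu', hv.sup hv', ?_, ?_, ?_⟩
      · rw [hf.map_sup]
        exact sup_le huz huz'
      · rw [hf.map_sup]
        exact sup_le hvz hvz'
      · rw [dm_sup, dm_sup, inf_inf_inf_comm])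
    (by
      rintro ⟨u, v, hu, hv, huz, hvz, h⟩
      have huv : u ⊔ v = ⊤ := by rw [← dm_dm (u ⊔ v), dm_sup, h, dm_bot]
      refine hzf ⟨u, le_antisymm huz ?_⟩
      calc z = z ⊓ f u ⊔ z ⊓ f v := by
            rw [← inf_sup_left, ← hf.map_sup, huv, hf.map_top, inf_top_eq]
        _ ≤ f u ⊔ z ⊓ dm z := sup_le_sup inf_le_right (inf_le_inf_left _ hvz)
        _ = f u := by rw [show z ⊓ dm z = ⊥ from hz, sup_bot_eq])
  have below : ∀ {y : B} {w : A}, IsCentral y → f w ⊓ y = ⊥ → f w ≤ dm y := fun {y w} hy h => by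
    rw [← inf_eq_left]
    calc f w ⊓ dm y = f w ⊓ y ⊔ f w ⊓ dm y := by rw [h, bot_sup_eq]
      _ = f w := by rw [← inf_sup_left, hy.sup_dm, inf_top_eq]
  have hbot : f (dm ⊤) = ⊥ := by rw [dm_top, hf.map_bot]
  obtain ⟨Q, hQ, hPQ, hzQ⟩ := hP.exists_liesOver hf (z := z) fun w hw hwP h => by
    refine hP' _ ⟨dm ⊤, w, isCentral_top.dm, hw, hbot ▸ bot_le, below hz h, rfl⟩ ?_
    rw [dm_dm, top_inf_eq, hP.dm_mem_iff hw]
    exact hwP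
  obtain ⟨Q', hQ', hPQ', hzQ'⟩ := hP.exists_liesOver hf (z := dm z) fun w hw hwP h => by
    refine hP' _ ⟨w, dm ⊤, hw, isCentral_top.dm, dm_dm z ▸ below hz.dm h, hbot ▸ bot_le, rfl⟩ ?_
    rw [dm_dm, inf_top_eq, hP.dm_mem_iff hw]
    exact hwP
  rw [hQ'.dm_mem_iff hz, not_not] at hzQ'
  exact ⟨P, Q, Q', hP, hQ, hQ', hPQ, hPQ', hzQ, hzQ'⟩

end RUNO1

/-! ### The amalgam and its embeddings -/

theorem IsHom.pi {B : Type u} [LAlg B] {I : Type u} {D : I → Type u} [∀ i, LAlg (D i)]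
    {p : ∀ i, B → D i} (hp : ∀ i, IsHom (p i)) : IsHom fun b i => p i b where
  map_sup x y := funext fun i => (hp i).map_sup x y
  map_inf x y := funext fun i => (hp i).map_inf x y
  map_imp x y := funext fun i => (hp i).map_imp x y
  map_dm x := funext fun i => (hp i).map_dm x
  map_bot := funext fun i => (hp i).map_bot
  map_top := funext fun i => (hp i).map_top

/-- Compatible triples of prime sets: the points of the amalgam of `f` and `g`. -/
structure AmalgamPoint {A B C : Type u} [LAlg A] [LAlg B] [LAlg C] (f : A → B) (g : A → C) :
    Type u where
  /-- The prime set of `A`. -/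
  base : Set A
  /-- The prime set of `B`. -/
  left : Set B
  /-- The prime set of `C`. -/
  right : Set C
  isPrimeSet_base : IsPrimeSet base
  isPrimeSet_left : IsPrimeSet left
  isPrimeSet_right : IsPrimeSet right
  liesOver_left : LiesOver f base left
  liesOver_right : LiesOver g base right

section Amalgam

variable {A B C : Type u} [LAlg A] [LAlg B] [LAlg C] [Fact (IsRUNO1 A)] [Fact (IsRUNO1 B)]
  [Fact (IsRUNO1 C)] {f : A → B} {g : A → C}

omit [Fact (IsRUNO1 B)] in
theorem exists_amalgamPoint_left (hf : IsHom f) (hg : IsEmb g) {Q : Set B} (hQ : IsPrimeSet Q) :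
    ∃ j : AmalgamPoint f g, j.left = Q := by
  have hP := hQ.preimage hf
  obtain ⟨R, hR, hPR⟩ := hP.exists_liesOver_of_isEmb hg
  exact ⟨⟨_, Q, R, hP, hQ, hR, fun _ _ => Iff.rfl, hPR⟩, rfl⟩

omit [Fact (IsRUNO1 C)] in
theorem exists_amalgamPoint_right (hf : IsEmb f) (hg : IsHom g) {R : Set C} (hR : IsPrimeSet R) :
    ∃ j : AmalgamPoint f g, j.right = R := by
  have hP := hR.preimage hg
  obtain ⟨Q, hQ, hPQ⟩ := hP.exists_liesOver_of_isEmb hf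
  exact ⟨⟨_, Q, R, hP, hQ, hR, hPQ, fun _ _ => Iff.rfl⟩, rfl⟩

/-- The amalgam of `f` and `g`: the product of the quotients at all compatible triples. -/
abbrev Amalgam (f : A → B) (g : A → C) : Type u :=
  ∀ j : AmalgamPoint f g, j.isPrimeSet_base.Quot

/-- The map from the left algebra to the amalgam. -/
noncomputable def Amalgam.inl (hf : IsHom f) (g : A → C) (b : B) : Amalgam f g := fun j =>
  j.isPrimeSet_base.transfer hf j.isPrimeSet_left b

/-- The map from the right algebra to the amalgam. -/
noncomputable def Amalgam.inr (f : A → B) (hg : IsHom g) (c : C) : Amalgam f g := fun j =>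
  j.isPrimeSet_base.transfer hg j.isPrimeSet_right c

theorem Amalgam.isEmb_inl (hf : IsHom f) (hg : IsEmb g) : IsEmb (Amalgam.inl hf g) where
  toIsHom := IsHom.pi fun j =>
    j.isPrimeSet_base.isHom_transfer hf j.isPrimeSet_left j.liesOver_left
  injective b b' h := by
    by_contra hne
    obtain ⟨Q, hQ, hmem⟩ := exists_isPrimeSet_mem (isCentral_agree b b')
      fun h' => hne (eq_of_agree_eq_top h')
    obtain ⟨j, rfl⟩ := exists_amalgamPoint_left hf hg hQ
    exact j.isPrimeSet_base.transfer_eq_transfer hf hQ j.liesOver_left (congrFun h j) hmem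

theorem Amalgam.isEmb_inr (hf : IsEmb f) (hg : IsHom g) : IsEmb (Amalgam.inr f hg) where
  toIsHom := IsHom.pi fun j =>
    j.isPrimeSet_base.isHom_transfer hg j.isPrimeSet_right j.liesOver_right
  injective c c' h := by
    by_contra hne
    obtain ⟨R, hR, hmem⟩ := exists_isPrimeSet_mem (isCentral_agree c c')
      fun h' => hne (eq_of_agree_eq_top h')
    obtain ⟨j, rfl⟩ := exists_amalgamPoint_right hf hg hR
    exact j.isPrimeSet_base.transfer_eq_transfer hg hR j.liesOver_right (congrFun h j) hmem

theorem Amalgam.inl_comp_eq (hf : IsHom f) (hg : IsHom g) :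
    Amalgam.inl hf g ∘ f = Amalgam.inr f hg ∘ g := by
  funext a j
  exact (j.isPrimeSet_base.transfer_apply hf j.isPrimeSet_left j.liesOver_left a).trans
    (j.isPrimeSet_base.transfer_apply hg j.isPrimeSet_right j.liesOver_right a).symm

/-- At (P, Q, R) and (P, Q', R) the element c has the same coordinate, hence so does b. But b is
congruent to f k modulo Q and not modulo Q'. -/
theorem Amalgam.mem_range_of_inl_eq_inr (hf : IsHom f) (hg : IsEmb g) {b : B} {c : C}
    (h : Amalgam.inl hf g b = Amalgam.inr f hg.toIsHom c) : b ∈ Set.range f := by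
  by_contra hb
  obtain ⟨k, hk⟩ := exists_agree_notMem_range hf hb
  obtain ⟨P, Q, Q', hP, hQ, hQ', hPQ, hPQ', hmem, hmem'⟩ :=
    exists_liesOver_separating hf (isCentral_agree b (f k)) hk
  obtain ⟨R, hR, hPR⟩ := hP.exists_liesOver_of_isEmb hg
  have h1 : hP.transfer hf hQ b = hP.transfer hg.toIsHom hR c :=
    congrFun h ⟨P, Q, R, hP, hQ, hR, hPQ, hPR⟩
  have h2 : hP.transfer hf hQ' b = hP.transfer hg.toIsHom hR c :=
    congrFun h ⟨P, Q', R, hP, hQ', hR, hPQ', hPR⟩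
  exact (hP.transfer_eq_iff hf hQ' hPQ').1
    ((h2.trans h1.symm).trans ((hP.transfer_eq_iff hf hQ hPQ).2 hmem)) hmem'

end Amalgam

end Unorthodox

/-- Every subvariety of `RUNO1` has the strong amalgamation property. -/
theorem corollary4p23 (V : Set Unorthodox.Alg.{u}) (hV : Unorthodox.IsVariety V)
    (hsub : V ⊆ Unorthodox.RUNO1) : Unorthodox.HasSAP V := by
  intro A hA B hB C hC f g hf hg
  have hA' : Fact (Unorthodox.IsRUNO1 A) := ⟨hsub hA⟩
  have hB' : Fact (Unorthodox.IsRUNO1 B) := ⟨hsub hB⟩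
  have hC' : Fact (Unorthodox.IsRUNO1 C) := ⟨hsub hC⟩
  refine ⟨Unorthodox.Alg.mk (Unorthodox.Amalgam f g),
    hV.product _ (fun j : Unorthodox.AmalgamPoint f g =>
      Unorthodox.Alg.mk j.isPrimeSet_base.Quot) fun j =>
      hV.hom_image A hA _ _ j.isPrimeSet_base.isHom_proj j.isPrimeSet_base.proj_surjective,
    Unorthodox.Amalgam.inl hf.toIsHom g, Unorthodox.Amalgam.inr f hg.toIsHom,
    Unorthodox.Amalgam.isEmb_inl hf.toIsHom hg, Unorthodox.Amalgam.isEmb_inr hf hg.toIsHom,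
    Unorthodox.Amalgam.inl_comp_eq hf.toIsHom hg.toIsHom, Set.Subset.antisymm ?_ ?_⟩
  · rintro _ ⟨⟨b, rfl⟩, c, hc⟩
    obtain ⟨a, rfl⟩ := Unorthodox.Amalgam.mem_range_of_inl_eq_inr hf.toIsHom hg hc.symm
    exact ⟨a, rfl⟩
  · rintro _ ⟨a, rfl⟩
    exact ⟨⟨f a, rfl⟩, g a,
      (congrFun (Unorthodox.Amalgam.inl_comp_eq hf.toIsHom hg.toIsHom) a).symm⟩
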